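/- Let $L$ be a one-sorted first-order language containing four distinct symbols $0,1$ (constants) and $+,\times$ (binary), and possibly others. A *scalar rewrite system* on $L$ is a set $S$ of rewrite rules on terms of $L$ (used either as a plain rewrite system or, more generally, modulo associativity and commutativity of a set $A$ of binary symbols of $L$; $A=\emptyset$ is the plain case) such that: $S$ terminates; $S$ is confluent on closed terms; for all closed terms $\lambda,\mu,\nu$ the two members of each of the following pairs have the same normal form: $0+\lambda$ and $\lambda$; $0\times\lambda$ and $0$; $1\times\lambda$ and $\lambda$; $\lambda\times(\mu+\nu)$ and $(\lambda\times\mu)+(\lambda\times\nu)$; $(\lambda+\mu)+\nu$ and $\lambda+(\mu+\nu)$; $\lambda+\mu$ and $\mu+\lambda$; $(\lambda\times\mu)\times\nu$ and $\lambda\times(\mu\times\nu)$; $\lambda\times\mu$ and $\mu\times\lambda$; and $0$ and $1$ are normal. (Confluence and equality of normal forms are understood modulo associativity and commutativity of the symbols in $A$.) Consider the language with four sorts $K,E,F,G$ whose symbols are those of $L$ on sort $K$, a copy of the symbols $+$ (vector sum), $.$ (product of a scalar and a vector) and $\mathbf 0$ for each of the sorts $E,F,G$, and a symbol $\otimes$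 of rank $\langle E,F,G\rangle$. Let $R'$ consist of the following rules, the first nine in one copy for each of the sorts $E,F,G$: $$u+\mathbf 0\to u,\quad 0.u\to\mathbf 0,\quad 1.u\to u,\quad \lambda.\mathbf 0\to\mathbf 0,\quad \lambda.(\mu.u)\to(\lambda\times\mu).u,$$ $$\lambda.u+\mu.u\to(\lambda+\mu).u,\quad \lambda.u+u\to(\lambda+1).u,\quad u+u\to(1+1).u,\quad \lambda.(u+v)\to\lambda.u+\lambda.v,$$ $$(u+v)\otimes w\to(u\otimes w)+(v\otimes w),\quad (\lambda.u)\otimes v\to\lambda.(u\otimes v),\quad u\otimes(v+w)\to(u\otimes v)+(u\otimes w),$$ $$u\otimes(\lambda.v)\to\lambda.(u\otimes v),\quad \mathbf 0\otimes u\to\mathbf 0,\quad u\otimes\mathbf 0\to\mathbf 0.$$ Terms are rewritten by $R'\cup S$ modulo associativity and commutativity of the three vector sums (and of the symbols in $A$). Then, for every scalar rewrite system $S$, the system $R'\cup S$ terminates (on all terms, with variables of any sort), and it is confluent, modulo the same associativity and commutativity, on the terms (of any of the four sorts) that contain variables of sorts $E$, $F$ and $G$ but no variables of sort $K$. -/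

import Mathlib

universe u v w x

namespace BilinearRewriting

/-! ## Abstract rewriting -/

/-- `r` terminates: there is no infinite reduction `t₀ r t₁ r t₂ r ...`. -/
def Terminating {α : Type*} (r : α → α → Prop) : Prop :=
  WellFounded (fun a b => r b a)

/-- `t` is normal for `r`: it has no `r`-reduct. -/
def IsNormal {α : Type*} (r : α → α → Prop) (t : α) : Prop :=
  ∀ u, ¬ r t u

/-- Rewriting modulo an equivalence `e`: from `t`, go to an equivalent `t'`, make one step
`t' → u'`, and end in any `u` equivalent to `u'`. -/
def Modulo {α : Type*} (e r : α → α → Prop) (t u : α) : Prop :=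
  ∃ t' u', e t t' ∧ r t' u' ∧ e u' u

/-- Confluence of `r`, where terms are identified modulo the equivalence `e`: two reducts of
the same term have reducts which are `e`-equivalent. (For `e` the equality, this is ordinary
confluence.) -/
def ConfluentModulo {α : Type*} (e r : α → α → Prop) : Prop :=
  ∀ t u₁ u₂, Relation.ReflTransGen r t u₁ → Relation.ReflTransGen r t u₂ →
    ∃ w₁ w₂, Relation.ReflTransGen r u₁ w₁ ∧ Relation.ReflTransGen r u₂ w₂ ∧ e w₁ w₂

/-- `t` and `u` have the same normal form (modulo `e`). -/
def SameNormalForm {α : Type*} (e r : α → α → Prop) (t u : α) : Prop :=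
  ∃ n m, Relation.ReflTransGen r t n ∧ IsNormal r n ∧
    Relation.ReflTransGen r u m ∧ IsNormal r m ∧ e n m

/-! ## Scalars -/

/-- One-step rewriting on terms of the one-sorted language `L` by a set of rules `l ⟶ r`: an
instance of a left-hand side, at some occurrence, is replaced by the corresponding instance of the
right-hand side. -/
inductive ScalarStep {L : FirstOrder.Language.{u, v}} (rules : Set (L.Term ℕ × L.Term ℕ)) {α : Type w} :
    L.Term α → L.Term α → Prop
  | rule {l r : L.Term ℕ} (h : (l, r) ∈ rules) (σ : ℕ → L.Term α) :
      ScalarStep rules (l.subst σ) (r.subst σ)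
  | arg {n : ℕ} (f : L.Functions n) (ts : Fin n → L.Term α) (i : Fin n) (t : L.Term α)
      (h : ScalarStep rules (ts i) t) :
      ScalarStep rules (FirstOrder.Language.Term.func f ts)
        (FirstOrder.Language.Term.func f (Function.update ts i t))

/-- Equality of terms of `L` modulo associativity and commutativity of the binary symbols in
`ac`. If `ac = ∅` this is just equality of terms. -/
inductive ScalarAC {L : FirstOrder.Language.{u, v}} (ac : Set (L.Functions 2)) {α : Type w} :
    L.Term α → L.Term α → Prop
  | refl (t : L.Term α) : ScalarAC ac t t
  | symm {t u : L.Term α} : ScalarAC ac t u → ScalarAC ac u t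
  | trans {t u v : L.Term α} : ScalarAC ac t u → ScalarAC ac u v → ScalarAC ac t v
  | congr {n : ℕ} (f : L.Functions n) {ts us : Fin n → L.Term α}
      (h : ∀ i, ScalarAC ac (ts i) (us i)) :
      ScalarAC ac (FirstOrder.Language.Term.func f ts) (FirstOrder.Language.Term.func f us)
  | comm {f : L.Functions 2} (hf : f ∈ ac) (t u : L.Term α) :
      ScalarAC ac (f.apply₂ t u) (f.apply₂ u t)
  | assoc {f : L.Functions 2} (hf : f ∈ ac) (t u v : L.Term α) :
      ScalarAC ac (f.apply₂ (f.apply₂ t u) v) (f.apply₂ t (f.apply₂ u v))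

/-- Four distinct symbols `0`, `1` (constants) and `+`, `×` (binary) of a language. -/
structure ScalarSymbols (L : FirstOrder.Language.{u, v}) where
  zero : L.Functions 0
  one : L.Functions 0
  add : L.Functions 2
  mul : L.Functions 2
  zero_ne_one : zero ≠ one
  add_ne_mul : add ≠ mul

namespace ScalarSymbols

variable {L : FirstOrder.Language.{u, v}} (c : ScalarSymbols L) {α : Type w}

/-- The term `0`. -/
def tzero : L.Term α := FirstOrder.Language.Term.func c.zero (fun i => i.elim0)

/-- The term `1`. -/
def tone : L.Term α := FirstOrder.Language.Term.func c.one (fun i => i.elim0)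

/-- The term `a + b`. -/
def tadd (a b : L.Term α) : L.Term α := c.add.apply₂ a b

/-- The term `a × b`. -/
def tmul (a b : L.Term α) : L.Term α := c.mul.apply₂ a b

end ScalarSymbols

/-- A set of rewrite rules on a language containing `+`, `×`, `0`, `1` (and possibly other
symbols), used modulo associativity and commutativity of the symbols in `ac`; `ac = ∅` is the case
of plain rewriting. -/
structure ScalarRules (L : FirstOrder.Language.{u, v}) extends ScalarSymbols L where
  rules : Set (L.Term ℕ × L.Term ℕ)
  ac : Set (L.Functions 2)

/-- One-step rewriting by `S`. -/
def ScalarRules.Step {L : FirstOrder.Language.{u, v}} (S : ScalarRules L) {α : Type w} :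
    L.Term α → L.Term α → Prop :=
  Modulo (ScalarAC S.ac) (ScalarStep S.rules)

/-- The closed terms `a` and `b` have the same normal form for `S`. -/
def ScalarRules.Same {L : FirstOrder.Language.{u, v}} (S : ScalarRules L) (a b : L.Term Empty) : Prop :=
  SameNormalForm (ScalarAC S.ac) S.Step a b

/-- Scalar rewrite systems. Closed terms are the terms over the empty set of variables. -/
structure IsScalarRewriteSystem {L : FirstOrder.Language.{u, v}} (S : ScalarRules L) : Prop where
  terminating : Terminating (S.Step (α := ℕ))
  ground_confluent : ConfluentModulo (ScalarAC S.ac) (S.Step (α := Empty))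
  zero_add : ∀ a : L.Term Empty, S.Same (S.tadd S.tzero a) a
  zero_mul : ∀ a : L.Term Empty, S.Same (S.tmul S.tzero a) S.tzero
  one_mul : ∀ a : L.Term Empty, S.Same (S.tmul S.tone a) a
  mul_add : ∀ a b c : L.Term Empty,
    S.Same (S.tmul a (S.tadd b c)) (S.tadd (S.tmul a b) (S.tmul a c))
  add_assoc : ∀ a b c : L.Term Empty,
    S.Same (S.tadd (S.tadd a b) c) (S.tadd a (S.tadd b c))
  add_comm : ∀ a b : L.Term Empty, S.Same (S.tadd a b) (S.tadd b a)
  mul_assoc : ∀ a b c : L.Term Empty,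
    S.Same (S.tmul (S.tmul a b) c) (S.tmul a (S.tmul b c))
  mul_comm : ∀ a b : L.Term Empty, S.Same (S.tmul a b) (S.tmul b a)
  zero_normal : IsNormal S.Step (S.tzero : L.Term Empty)
  one_normal : IsNormal S.Step (S.tone : L.Term Empty)

/-! ## Vectors -/

/-- The three sorts of vectors. -/
inductive VSort
  | E
  | F
  | G

/-- Terms of the vector sorts `E`, `F`, `G`, where scalars are terms of the language `L` with
variables in `VK` and where `V s` is the set of variables of the vector sort `s`. -/
inductive VTerm (L : FirstOrder.Language.{u, v}) (VK : Type w) (V : VSort → Type x) :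
    VSort → Type (max u w x)
  | var {s : VSort} (y : V s) : VTerm L VK V s
  | zero {s : VSort} : VTerm L VK V s
  | add {s : VSort} (t u : VTerm L VK V s) : VTerm L VK V s
  | smul {s : VSort} (a : L.Term VK) (t : VTerm L VK V s) : VTerm L VK V s
  | tensor (t : VTerm L VK V VSort.E) (u : VTerm L VK V VSort.F) : VTerm L VK V VSort.G

/-- The instances `σl ⟶ σr` of the rules of the system `R'`: the first nine rules form the
system `R`, in one copy for each vector sort `s`. -/
inductive VRule {L : FirstOrder.Language.{u, v}} (c : ScalarSymbols L) {VK : Type w} {V : VSort → Type x} :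
    {s : VSort} → VTerm L VK V s → VTerm L VK V s → Prop
  | add_zero {s : VSort} (t : VTerm L VK V s) : VRule c (.add t .zero) t
  | zero_smul {s : VSort} (t : VTerm L VK V s) : VRule c (.smul c.tzero t) .zero
  | one_smul {s : VSort} (t : VTerm L VK V s) : VRule c (.smul c.tone t) t
  | smul_zero {s : VSort} (a : L.Term VK) :
      VRule c (.smul a (.zero : VTerm L VK V s)) .zero
  | smul_smul {s : VSort} (a b : L.Term VK) (t : VTerm L VK V s) :
      VRule c (.smul a (.smul b t)) (.smul (c.tmul a b) t)
  | add_smul {s : VSort} (a b : L.Term VK) (t : VTerm L VK V s) :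
      VRule c (.add (.smul a t) (.smul b t)) (.smul (c.tadd a b) t)
  | add_smul_one {s : VSort} (a : L.Term VK) (t : VTerm L VK V s) :
      VRule c (.add (.smul a t) t) (.smul (c.tadd a c.tone) t)
  | add_self {s : VSort} (t : VTerm L VK V s) :
      VRule c (.add t t) (.smul (c.tadd c.tone c.tone) t)
  | smul_add {s : VSort} (a : L.Term VK) (t u : VTerm L VK V s) :
      VRule c (.smul a (.add t u)) (.add (.smul a t) (.smul a u))
  | add_tensor (t u : VTerm L VK V VSort.E) (z : VTerm L VK V VSort.F) :
      VRule c (.tensor (.add t u) z) (.add (.tensor t z) (.tensor u z))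
  | smul_tensor (a : L.Term VK) (t : VTerm L VK V VSort.E) (z : VTerm L VK V VSort.F) :
      VRule c (.tensor (.smul a t) z) (.smul a (.tensor t z))
  | tensor_add (t : VTerm L VK V VSort.E) (z y : VTerm L VK V VSort.F) :
      VRule c (.tensor t (.add z y)) (.add (.tensor t z) (.tensor t y))
  | tensor_smul (a : L.Term VK) (t : VTerm L VK V VSort.E) (z : VTerm L VK V VSort.F) :
      VRule c (.tensor t (.smul a z)) (.smul a (.tensor t z))
  | zero_tensor (z : VTerm L VK V VSort.F) : VRule c (.tensor .zero z) .zero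
  | tensor_zero (t : VTerm L VK V VSort.E) : VRule c (.tensor t .zero) .zero

/-- One rewrite step in a vector term, at any occurrence, by a rule of `R'` or (inside a scalar
subterm) by a rule of `S`; not yet modulo associativity and commutativity. -/
inductive VStep {L : FirstOrder.Language.{u, v}} (S : ScalarRules L) {VK : Type w} {V : VSort → Type x} :
    {s : VSort} → VTerm L VK V s → VTerm L VK V s → Prop
  | root {s : VSort} {t u : VTerm L VK V s} (h : VRule S.toScalarSymbols t u) : VStep S t u
  | scalar {s : VSort} {a b : L.Term VK} (t : VTerm L VK V s) (h : ScalarStep S.rules a b) :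
      VStep S (.smul a t) (.smul b t)
  | smul {s : VSort} (a : L.Term VK) {t u : VTerm L VK V s} (h : VStep S t u) :
      VStep S (.smul a t) (.smul a u)
  | add_left {s : VSort} {t t' : VTerm L VK V s} (u : VTerm L VK V s) (h : VStep S t t') :
      VStep S (.add t u) (.add t' u)
  | add_right {s : VSort} (t : VTerm L VK V s) {u u' : VTerm L VK V s} (h : VStep S u u') :
      VStep S (.add t u) (.add t u')
  | tensor_left {t t' : VTerm L VK V VSort.E} (u : VTerm L VK V VSort.F) (h : VStep S t t') :
      VStep S (.tensor t u) (.tensor t' u)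
  | tensor_right (t : VTerm L VK V VSort.E) {u u' : VTerm L VK V VSort.F} (h : VStep S u u') :
      VStep S (.tensor t u) (.tensor t u')

/-- Equality of vector terms modulo associativity and commutativity of the three symbols `+` on
vectors (and, inside scalar subterms, of the symbols in `ac`). -/
inductive VAC {L : FirstOrder.Language.{u, v}} (ac : Set (L.Functions 2)) {VK : Type w}
    {V : VSort → Type x} : {s : VSort} → VTerm L VK V s → VTerm L VK V s → Prop
  | refl {s : VSort} (t : VTerm L VK V s) : VAC ac t t
  | symm {s : VSort} {t u : VTerm L VK V s} : VAC ac t u → VAC ac u t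
  | trans {s : VSort} {t u z : VTerm L VK V s} : VAC ac t u → VAC ac u z → VAC ac t z
  | add {s : VSort} {t t' u u' : VTerm L VK V s} (ht : VAC ac t t') (hu : VAC ac u u') :
      VAC ac (.add t u) (.add t' u')
  | smul {s : VSort} {a a' : L.Term VK} {t t' : VTerm L VK V s} (ha : ScalarAC ac a a')
      (ht : VAC ac t t') : VAC ac (.smul a t) (.smul a' t')
  | tensor {t t' : VTerm L VK V VSort.E} {u u' : VTerm L VK V VSort.F} (ht : VAC ac t t')
      (hu : VAC ac u u') : VAC ac (.tensor t u) (.tensor t' u')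
  | comm {s : VSort} (t u : VTerm L VK V s) : VAC ac (.add t u) (.add u t)
  | assoc {s : VSort} (t u z : VTerm L VK V s) :
      VAC ac (.add (.add t u) z) (.add t (.add u z))

/-! ## The four-sorted language -/

/-- Terms, of any of the four sorts `K`, `E`, `F`, `G`. -/
inductive Term (L : FirstOrder.Language.{u, v}) (VK : Type w) (V : VSort → Type x) : Type (max u w x)
  | scalar (a : L.Term VK) : Term L VK V
  | vector {s : VSort} (t : VTerm L VK V s) : Term L VK V

/-- One step of `R' ∪ S` at some occurrence, not yet modulo associativity and commutativity. -/
inductive TermStep {L : FirstOrder.Language.{u, v}} (S : ScalarRules L) {VK : Type w}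
    {V : VSort → Type x} : Term L VK V → Term L VK V → Prop
  | scalar {a b : L.Term VK} (h : ScalarStep S.rules a b) : TermStep S (.scalar a) (.scalar b)
  | vector {s : VSort} {t u : VTerm L VK V s} (h : VStep S t u) :
      TermStep S (.vector t) (.vector u)

/-- Equality of terms of any sort modulo associativity and commutativity of `+` on vectors and of
the scalar symbols in `ac`. -/
inductive TermAC {L : FirstOrder.Language.{u, v}} (ac : Set (L.Functions 2)) {VK : Type w}
    {V : VSort → Type x} : Term L VK V → Term L VK V → Prop
  | scalar {a b : L.Term VK} (h : ScalarAC ac a b) : TermAC ac (.scalar a) (.scalar b)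
  | vector {s : VSort} {t u : VTerm L VK V s} (h : VAC ac t u) :
      TermAC ac (.vector t) (.vector u)

/-- One-step rewriting by the system `R' ∪ S`. -/
def Rewrites {L : FirstOrder.Language.{u, v}} (S : ScalarRules L) (VK : Type w) (V : VSort → Type x) :
    Term L VK V → Term L VK V → Prop :=
  Modulo (TermAC S.ac) (TermStep S)

end BilinearRewriting

namespace BilinearRewriting

open Relation FirstOrder FirstOrder.Language

/-! ## Abstract rewriting -/

section Abstract

variable {α : Type*} {e r : α → α → Prop}

/-! Termination comes from a lexicographic measure. Its first component is a polynomial size that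
ignores scalars, is AC-invariant, and drops under every rule of `R'` (`VRule.size_lt`). Its second
is the multiset of ordinal ranks of the scalars that occur. A step of `S` keeps the size and
replaces one rank by a smaller one. Rules of `R'` may copy scalars or create new ones, which is
harmless because the size comes first.

Confluence is semantic, with no critical pairs. Without scalar variables all scalars are closed, and
modulo `S` they form a nontrivial commutative semiring. Vector terms are evaluated in free modules
over it, with the variables as basis, together with the tensors of two variables for sort `G`.
Rewriting and AC preserve the value (`VRule.eval_eq`, `VAC.eval_eq`). Conversely, a normal term is,
up to AC, the sum of monomials read off its value (`VTerm.ofTerm_eq_canonical`), so normal terms of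
equal value are AC-equal. Together with termination this gives confluence
(`confluentModulo_of_invariant`). -/

theorem Modulo.congr_left (he : Equivalence e) {a b c : α} (hab : e a b) (h : Modulo e r b c) :
    Modulo e r a c := by
  obtain ⟨b', c', h₁, h₂, h₃⟩ := h
  exact ⟨b', c', he.trans hab h₁, h₂, h₃⟩

theorem Modulo.of_step (he : Equivalence e) {a b : α} (h : r a b) : Modulo e r a b :=
  ⟨a, b, he.refl a, h, he.refl b⟩

theorem Modulo.map {β : Type*} {e' r' : β → β → Prop} {f : α → β}
    (hf : ∀ a b, e a b → e' (f a) (f b)) (hr : ∀ a b, r a b → r' (f a) (f b)) {a b : α}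
    (h : Modulo e r a b) : Modulo e' r' (f a) (f b) := by
  obtain ⟨a', b', h₁, h₂, h₃⟩ := h
  exact ⟨f a', f b', hf _ _ h₁, hr _ _ h₂, hf _ _ h₃⟩

theorem IsNormal.congr (he : Equivalence e) {a b : α} (hab : e a b)
    (h : IsNormal (Modulo e r) a) : IsNormal (Modulo e r) b :=
  fun _ hc => h _ (hc.congr_left he hab)

theorem IsNormal.eq_of_reflTransGen {a b : α} (h : IsNormal r a) (hab : ReflTransGen r a b) :
    a = b := by
  rcases hab.cases_head with rfl | ⟨c, hc, -⟩
  · rfl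
  · exact absurd hc (h c)

theorem Terminating.exists_normal (hr : Terminating r) (a : α) :
    ∃ n, ReflTransGen r a n ∧ IsNormal r n := by
  induction a using hr.induction with
  | _ a ih =>
    by_cases h : IsNormal r a
    · exact ⟨a, .refl, h⟩
    · simp only [IsNormal, not_forall, not_not] at h
      obtain ⟨b, hb⟩ := h
      obtain ⟨n, hn, hn'⟩ := ih b hb
      exact ⟨n, .head hb hn, hn'⟩

/-- A first step modulo `e` absorbs `hab`; only the empty reduction leaves a residual equivalence at
the end. -/
theorem ReflTransGen.congr_modulo (he : Equivalence e) {a b c : α} (hab : e a b)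
    (h : ReflTransGen (Modulo e r) a c) : ∃ d, ReflTransGen (Modulo e r) b d ∧ e c d := by
  rcases h.cases_head with rfl | ⟨d, hd, hd'⟩
  · exact ⟨b, .refl, hab⟩
  · exact ⟨c, .head (hd.congr_left he (he.symm hab)) hd', he.refl c⟩

/-- An invariant which separates normal forms up to `e` gives confluence modulo `e`. -/
theorem confluentModulo_of_invariant (hr : Terminating r)
    {β : Type*} (f : α → β) (hf : ∀ a b, r a b → f a = f b)
    (hn : ∀ a b, IsNormal r a → IsNormal r b → f a = f b → e a b) : ConfluentModulo e r := by
  have key : ∀ {a b}, ReflTransGen r a b → f a = f b := fun h => by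
    induction h with
    | refl => rfl
    | tail _ h ih => exact ih.trans (hf _ _ h)
  intro t u₁ u₂ h₁ h₂
  obtain ⟨n₁, hn₁, hn₁'⟩ := hr.exists_normal u₁
  obtain ⟨n₂, hn₂, hn₂'⟩ := hr.exists_normal u₂
  exact ⟨n₁, n₂, hn₁, hn₂, hn _ _ hn₁' hn₂'
    ((key (h₁.trans hn₁)).symm.trans (key (h₂.trans hn₂)))⟩

/-- The Church–Rosser property, by induction on the conversion. Confluence enters only for
transitivity, at the middle term. -/
theorem exists_common_normal (he : Equivalence e) (hr : Terminating (Modulo e r))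
    (hc : ConfluentModulo e (Modulo e r)) {a b : α}
    (h : Relation.EqvGen (fun a b => Modulo e r a b ∨ e a b) a b) :
    ∃ n m, ReflTransGen (Modulo e r) a n ∧ IsNormal (Modulo e r) n ∧
      ReflTransGen (Modulo e r) b m ∧ IsNormal (Modulo e r) m ∧ e n m := by
  induction h with
  | refl a =>
    obtain ⟨n, hn, hn'⟩ := hr.exists_normal a
    exact ⟨n, n, hn, hn', hn, hn', he.refl n⟩
  | symm a b _ ih =>
    obtain ⟨n, m, h₁, h₂, h₃, h₄, h₅⟩ := ih
    exact ⟨m, n, h₃, h₄, h₁, h₂, he.symm h₅⟩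
  | rel a b h =>
    rcases h with h | h
    · obtain ⟨n, hn, hn'⟩ := hr.exists_normal b
      exact ⟨n, n, .head h hn, hn', hn, hn', he.refl n⟩
    · obtain ⟨n, hn, hn'⟩ := hr.exists_normal a
      obtain ⟨m, hm, hm'⟩ := ReflTransGen.congr_modulo he h hn
      exact ⟨n, m, hn, hn', hm, hn'.congr he hm', hm'⟩
  | trans a b c _ _ ih₁ ih₂ =>
    obtain ⟨n, m, h₁, h₂, h₃, h₄, h₅⟩ := ih₁
    obtain ⟨n', m', h₁', h₂', h₃', h₄', h₅'⟩ := ih₂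
    obtain ⟨p, q, hp, hq, hpq⟩ := hc _ _ _ h₃ h₁'
    obtain rfl := h₄.eq_of_reflTransGen hp
    obtain rfl := h₂'.eq_of_reflTransGen hq
    exact ⟨n, m', h₁, h₂, h₃', h₄', he.trans h₅ (he.trans hpq h₅')⟩

end Abstract

/-! ## Scalar terms -/

section Scalar

variable {L : FirstOrder.Language.{u, v}}

theorem ScalarAC.equivalence (ac : Set (L.Functions 2)) {α : Type w} :
    Equivalence (ScalarAC ac (α := α)) :=
  ⟨.refl, .symm, .trans⟩

theorem subst_apply₂ {α : Type*} {β : Type*} (f : L.Functions 2) (t u : L.Term α)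
    (τ : α → L.Term β) : (f.apply₂ t u).subst τ = f.apply₂ (t.subst τ) (u.subst τ) := by
  simp only [Functions.apply₂, Term.subst]
  congr 1
  funext i
  fin_cases i <;> rfl

theorem subst_subst {α : Type*} {β : Type*} {γ : Type*} (t : L.Term α) (σ : α → L.Term β)
    (τ : β → L.Term γ) : (t.subst σ).subst τ = t.subst fun i => (σ i).subst τ := by
  induction t with
  | var => rfl
  | func f ts ih => simp only [Term.subst, ih]

theorem ScalarStep.subst {rules : Set (L.Term ℕ × L.Term ℕ)} {α : Type*} {β : Type*}
    (τ : α → L.Term β) {a b : L.Term α} (h : ScalarStep rules a b) :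
    ScalarStep rules (a.subst τ) (b.subst τ) := by
  induction h with
  | rule h σ =>
    rw [subst_subst, subst_subst]
    exact .rule h _
  | arg f ts i t h ih =>
    simp only [Term.subst]
    convert ScalarStep.arg f (fun j => (ts j).subst τ) i (t.subst τ) ih using 2
    funext j
    by_cases hj : j = i
    · subst hj; simp
    · simp [hj]

theorem ScalarAC.subst {ac : Set (L.Functions 2)} {α : Type*} {β : Type*}
    (τ : α → L.Term β) {a b : L.Term α} (h : ScalarAC ac a b) :
    ScalarAC ac (a.subst τ) (b.subst τ) := by
  induction h with
  | refl t => exact .refl _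
  | symm _ ih => exact .symm ih
  | trans _ _ ih₁ ih₂ => exact .trans ih₁ ih₂
  | congr f _ ih => exact .congr f ih
  | comm hf t u => simpa only [subst_apply₂] using .comm hf _ _
  | assoc hf t u v => simpa only [subst_apply₂] using .assoc hf _ _ _

theorem ScalarRules.Step.subst {S : ScalarRules L} {α : Type*} {β : Type*}
    (τ : α → L.Term β) {a b : L.Term α} (h : S.Step a b) : S.Step (a.subst τ) (b.subst τ) :=
  Modulo.map (f := fun a : L.Term α => a.subst τ) (fun _ _ h => h.subst τ) (fun _ _ h => h.subst τ) h

/-- Collapsing all variables to a single one sends reductions to reductions, so termination over `ℕ`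
covers any set of variables, the empty one included. -/
theorem IsScalarRewriteSystem.terminating_of_type {S : ScalarRules L}
    (hS : IsScalarRewriteSystem S) (α : Type w) : Terminating (S.Step (α := α)) :=
  Subrelation.wf (fun h => ScalarRules.Step.subst (fun _ => Term.var 0) h)
    (InvImage.wf (fun a : L.Term α => a.subst fun _ => (Term.var 0 : L.Term ℕ)) hS.terminating)

theorem ScalarAC.apply₂ {ac : Set (L.Functions 2)} {α : Type w} (f : L.Functions 2)
    {a a' b b' : L.Term α} (ha : ScalarAC ac a a') (hb : ScalarAC ac b b') :
    ScalarAC ac (f.apply₂ a b) (f.apply₂ a' b') :=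
  .congr f (by intro i; fin_cases i <;> assumption)

theorem ScalarStep.apply₂_left {rules : Set (L.Term ℕ × L.Term ℕ)} {α : Type w}
    (f : L.Functions 2) {a a' : L.Term α} (b : L.Term α) (ha : ScalarStep rules a a') :
    ScalarStep rules (f.apply₂ a b) (f.apply₂ a' b) := by
  have := ScalarStep.arg f ![a, b] 0 a' ha
  rwa [show Function.update ![a, b] 0 a' = ![a', b] by
    funext i; fin_cases i <;> rfl] at this

theorem ScalarStep.apply₂_right {rules : Set (L.Term ℕ × L.Term ℕ)} {α : Type w}
    (f : L.Functions 2) (a : L.Term α) {b b' : L.Term α} (hb : ScalarStep rules b b') :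
    ScalarStep rules (f.apply₂ a b) (f.apply₂ a b') := by
  have := ScalarStep.arg f ![a, b] 1 b' hb
  rwa [show Function.update ![a, b] 1 b' = ![a, b'] by
    funext i; fin_cases i <;> rfl] at this

/-- AC laws act on binary symbols only, so a constant is AC-equal to nothing but itself. This keeps
`0` and `1` apart. -/
theorem ScalarAC.eq_constant_iff {ac : Set (L.Functions 2)} {α : Type w} (k : L.Functions 0)
    {a b : L.Term α} (h : ScalarAC ac a b) :
    (∃ ts, a = Term.func k ts) ↔ ∃ ts, b = Term.func k ts := by
  induction h with
  | refl => rfl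
  | symm _ ih => exact ih.symm
  | trans _ _ ih₁ ih₂ => exact ih₁.trans ih₂
  | @congr n f ts us h _ =>
    constructor <;> rintro ⟨ts', h⟩ <;> cases h <;> exact ⟨_, rfl⟩
  | comm hf t u => constructor <;> rintro ⟨ts', h⟩ <;> cases h
  | assoc hf t u v => constructor <;> rintro ⟨ts', h⟩ <;> cases h

theorem ScalarSymbols.not_scalarAC_zero_one (c : ScalarSymbols L) (ac : Set (L.Functions 2))
    {α : Type w} : ¬ ScalarAC ac (c.tzero : L.Term α) c.tone := by
  intro h
  obtain ⟨ts, h'⟩ := (h.eq_constant_iff c.zero).1 ⟨_, rfl⟩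
  simp only [ScalarSymbols.tone, Term.func.injEq, heq_eq_eq, true_and] at h'
  exact c.zero_ne_one h'.1.symm

end Scalar

/-! ## The semiring of closed scalars -/

section ScalarModel

variable {L : FirstOrder.Language.{u, v}}

/-- The closed scalars, up to the congruence generated by `S`. -/
def ClosedScalar (S : ScalarRules L) (_ : IsScalarRewriteSystem S) : Type u :=
  Quot fun a b : L.Term Empty => S.Step a b ∨ ScalarAC S.ac a b

namespace ClosedScalar

variable {S : ScalarRules L} {hS : IsScalarRewriteSystem S}

/-- The class of a closed scalar. -/
def mk (hS : IsScalarRewriteSystem S) (a : L.Term Empty) : ClosedScalar S hS := Quot.mk _ a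

theorem mk_surjective (q : ClosedScalar S hS) : ∃ a, mk hS a = q := Quot.exists_rep q

theorem mk_eq_of_step {a b : L.Term Empty} (h : S.Step a b) : mk hS a = mk hS b :=
  Quot.sound (.inl h)

theorem mk_eq_of_scalarStep {a b : L.Term Empty} (h : ScalarStep S.rules a b) :
    mk hS a = mk hS b :=
  mk_eq_of_step (.of_step (ScalarAC.equivalence _) h)

theorem mk_eq_of_scalarAC {a b : L.Term Empty} (h : ScalarAC S.ac a b) : mk hS a = mk hS b :=
  Quot.sound (.inr h)

theorem mk_eq_of_reflTransGen {a b : L.Term Empty} (h : ReflTransGen S.Step a b) :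
    mk hS a = mk hS b := by
  induction h with
  | refl => rfl
  | tail _ h ih => exact ih.trans (mk_eq_of_step h)

theorem mk_eq_of_same {a b : L.Term Empty} (h : S.Same a b) : mk hS a = mk hS b := by
  obtain ⟨n, m, h₁, -, h₃, -, h₅⟩ := h
  rw [mk_eq_of_reflTransGen h₁, mk_eq_of_reflTransGen h₃, mk_eq_of_scalarAC h₅]

/-- This is where ground confluence of `S` is used: the quotient does not identify normal scalars
beyond AC. -/
theorem scalarAC_of_mk_eq {a b : L.Term Empty} (ha : IsNormal S.Step a) (hb : IsNormal S.Step b)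
    (h : mk hS a = mk hS b) : ScalarAC S.ac a b := by
  obtain ⟨n, m, h₁, -, h₃, -, h₅⟩ := exists_common_normal (ScalarAC.equivalence _)
    (hS.terminating_of_type Empty) hS.ground_confluent (Quot.eqvGen_exact h)
  rwa [ha.eq_of_reflTransGen h₁, hb.eq_of_reflTransGen h₃]

theorem exists_normal_rep (q : ClosedScalar S hS) : ∃ a, IsNormal S.Step a ∧ mk hS a = q := by
  obtain ⟨a, rfl⟩ := mk_surjective q
  obtain ⟨n, hn, hn'⟩ := (hS.terminating_of_type Empty).exists_normal a
  exact ⟨n, hn', (mk_eq_of_reflTransGen hn).symm⟩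

/-- The operation on classes of closed scalars given by a binary symbol. -/
def op (f : L.Functions 2) : ClosedScalar S hS → ClosedScalar S hS → ClosedScalar S hS :=
  Quot.map₂ f.apply₂
    (fun a _ _ h => h.imp
      (Modulo.map (f := fun b => f.apply₂ a b) (fun _ _ h => .apply₂ f (.refl a) h)
        (fun _ _ h => h.apply₂_right f a))
      (fun h => .apply₂ f (.refl a) h))
    (fun _ _ b h => h.imp
      (Modulo.map (f := fun a => f.apply₂ a b) (fun _ _ h => .apply₂ f h (.refl b))
        (fun _ _ h => h.apply₂_left f b))
      (fun h => .apply₂ f h (.refl b)))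

instance : Add (ClosedScalar S hS) := ⟨op S.add⟩
instance : Mul (ClosedScalar S hS) := ⟨op S.mul⟩
instance : Zero (ClosedScalar S hS) := ⟨mk hS S.tzero⟩
instance : One (ClosedScalar S hS) := ⟨mk hS S.tone⟩

theorem mk_tadd (a b : L.Term Empty) : mk hS (S.tadd a b) = mk hS a + mk hS b := rfl
theorem mk_tmul (a b : L.Term Empty) : mk hS (S.tmul a b) = mk hS a * mk hS b := rfl
theorem mk_tzero : mk hS S.tzero = 0 := rfl
theorem mk_tone : mk hS S.tone = 1 := rfl

protected theorem add_comm (a b : ClosedScalar S hS) : a + b = b + a := by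
  obtain ⟨a, rfl⟩ := mk_surjective a
  obtain ⟨b, rfl⟩ := mk_surjective b
  exact mk_eq_of_same (hS.add_comm a b)

protected theorem mul_comm (a b : ClosedScalar S hS) : a * b = b * a := by
  obtain ⟨a, rfl⟩ := mk_surjective a
  obtain ⟨b, rfl⟩ := mk_surjective b
  exact mk_eq_of_same (hS.mul_comm a b)

protected theorem zero_add (a : ClosedScalar S hS) : 0 + a = a := by
  obtain ⟨a, rfl⟩ := mk_surjective a
  exact mk_eq_of_same (hS.zero_add a)

protected theorem zero_mul (a : ClosedScalar S hS) : 0 * a = 0 := by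
  obtain ⟨a, rfl⟩ := mk_surjective a
  exact mk_eq_of_same (hS.zero_mul a)

protected theorem one_mul (a : ClosedScalar S hS) : 1 * a = a := by
  obtain ⟨a, rfl⟩ := mk_surjective a
  exact mk_eq_of_same (hS.one_mul a)

protected theorem mul_add (a b c : ClosedScalar S hS) : a * (b + c) = a * b + a * c := by
  obtain ⟨a, rfl⟩ := mk_surjective a
  obtain ⟨b, rfl⟩ := mk_surjective b
  obtain ⟨c, rfl⟩ := mk_surjective c
  exact mk_eq_of_same (hS.mul_add a b c)

instance : CommSemiring (ClosedScalar S hS) where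
  add_assoc a b c := by
    obtain ⟨a, rfl⟩ := mk_surjective a
    obtain ⟨b, rfl⟩ := mk_surjective b
    obtain ⟨c, rfl⟩ := mk_surjective c
    exact mk_eq_of_same (hS.add_assoc a b c)
  mul_assoc a b c := by
    obtain ⟨a, rfl⟩ := mk_surjective a
    obtain ⟨b, rfl⟩ := mk_surjective b
    obtain ⟨c, rfl⟩ := mk_surjective c
    exact mk_eq_of_same (hS.mul_assoc a b c)
  zero_add := ClosedScalar.zero_add
  add_zero a := by rw [ClosedScalar.add_comm, ClosedScalar.zero_add]
  add_comm := ClosedScalar.add_comm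
  zero_mul := ClosedScalar.zero_mul
  mul_zero a := by rw [ClosedScalar.mul_comm, ClosedScalar.zero_mul]
  one_mul := ClosedScalar.one_mul
  mul_one a := by rw [ClosedScalar.mul_comm, ClosedScalar.one_mul]
  mul_comm := ClosedScalar.mul_comm
  left_distrib := ClosedScalar.mul_add
  right_distrib a b c := by
    rw [ClosedScalar.mul_comm, ClosedScalar.mul_add, ClosedScalar.mul_comm c,
      ClosedScalar.mul_comm c]
  nsmul := nsmulRec
  npow := npowRec

/-- Ensures that a basis vector with coefficient `1` really has nonempty support. -/
instance : Nontrivial (ClosedScalar S hS) :=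
  ⟨0, 1, fun h => S.not_scalarAC_zero_one S.ac
    (scalarAC_of_mk_eq hS.zero_normal hS.one_normal h)⟩

end ClosedScalar

end ScalarModel

/-! ## Termination -/

section Termination

variable {L : FirstOrder.Language.{u, v}} {S : ScalarRules L}

/-- A rank depends only on the predecessors. AC-equal scalars have the same reducts modulo AC, hence
the same `scalarRank`. -/
theorem rank_le_of_imp {α : Type u} (r : α → α → Prop) [IsWellFounded α r] {a b : α}
    (h : ∀ c, r c a → r c b) : IsWellFounded.rank r a ≤ IsWellFounded.rank r b := by
  rw [IsWellFounded.rank_eq r a]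
  exact Ordinal.iSup_le fun c =>
    Order.succ_le_of_lt (IsWellFounded.rank_lt_of_rel (h c.1 c.2))

/-- The ordinal height of a scalar term, all variables being identified. -/
noncomputable def scalarRank (hS : IsScalarRewriteSystem S) {VK : Type w} (a : L.Term VK) :
    Ordinal.{u} :=
  haveI : IsWellFounded (L.Term ℕ) (fun a b => S.Step b a) := ⟨hS.terminating⟩
  IsWellFounded.rank (fun a b : L.Term ℕ => S.Step b a) (a.subst fun _ => Term.var 0)

theorem scalarRank_lt (hS : IsScalarRewriteSystem S) {VK : Type w} {a b : L.Term VK}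
    (h : ScalarStep S.rules a b) : scalarRank hS b < scalarRank hS a :=
  haveI : IsWellFounded (L.Term ℕ) (fun a b => S.Step b a) := ⟨hS.terminating⟩
  IsWellFounded.rank_lt_of_rel (r := fun a b : L.Term ℕ => S.Step b a)
    (ScalarRules.Step.subst _ (Modulo.of_step (ScalarAC.equivalence _) h))

theorem scalarRank_congr (hS : IsScalarRewriteSystem S) {VK : Type w} {a b : L.Term VK}
    (h : ScalarAC S.ac a b) : scalarRank hS a = scalarRank hS b :=
  haveI : IsWellFounded (L.Term ℕ) (fun a b => S.Step b a) := ⟨hS.terminating⟩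
  have key : ∀ {a b : L.Term VK}, ScalarAC S.ac a b → scalarRank hS a ≤ scalarRank hS b :=
    fun h => rank_le_of_imp (fun a b : L.Term ℕ => S.Step b a) fun _ hc =>
      Modulo.congr_left (ScalarAC.equivalence _) (h.symm.subst _) hc
  (key h).antisymm (key h.symm)

variable {VK : Type w} {V : VSort → Type x}

/-- A size of vector terms that each rule of `R'` decreases, and that ignores scalars. -/
def VTerm.size : {s : VSort} → VTerm L VK V s → ℕ
  | _, .var _ => 0
  | _, .zero => 0
  | _, .add t u => 2 + t.size + u.size
  | _, .smul _ t => 1 + 2 * t.size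
  | _, .tensor t u => (3 * t.size + 2) * (3 * u.size + 2)

/-- The ranks of the scalars which occur in a vector term. -/
noncomputable def VTerm.ranks (hS : IsScalarRewriteSystem S) :
    {s : VSort} → VTerm L VK V s → Multiset Ordinal.{u}
  | _, .var _ => 0
  | _, .zero => 0
  | _, .add t u => t.ranks hS + u.ranks hS
  | _, .smul a t => {scalarRank hS a} + t.ranks hS
  | _, .tensor t u => t.ranks hS + u.ranks hS

theorem VAC.size_eq {ac : Set (L.Functions 2)} {s : VSort} {t u : VTerm L VK V s}
    (h : VAC ac t u) : t.size = u.size := by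
  induction h with
  | refl => rfl
  | symm _ ih => exact ih.symm
  | trans _ _ ih₁ ih₂ => exact ih₁.trans ih₂
  | add _ _ ih₁ ih₂ => simp only [VTerm.size, ih₁, ih₂]
  | smul _ _ ih => simp only [VTerm.size, ih]
  | tensor _ _ ih₁ ih₂ => simp only [VTerm.size, ih₁, ih₂]
  | comm => simp only [VTerm.size]; omega
  | assoc => simp only [VTerm.size]; omega

theorem VAC.ranks_eq (hS : IsScalarRewriteSystem S) {s : VSort} {t u : VTerm L VK V s}
    (h : VAC S.ac t u) : t.ranks hS = u.ranks hS := by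
  induction h with
  | refl => rfl
  | symm _ ih => exact ih.symm
  | trans _ _ ih₁ ih₂ => exact ih₁.trans ih₂
  | add _ _ ih₁ ih₂ => simp only [VTerm.ranks, ih₁, ih₂]
  | smul ha _ ih => simp only [VTerm.ranks, ih, scalarRank_congr hS ha]
  | tensor _ _ ih₁ ih₂ => simp only [VTerm.ranks, ih₁, ih₂]
  | comm => simp only [VTerm.ranks, add_comm]
  | assoc => simp only [VTerm.ranks, add_assoc]

/-- The constants are fixed by the tight cases. Distributing a scalar over a sum gains exactly one.
Pulling a scalar out of a tensor gains the other factor minus one, and splitting a sum under a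
tensor gains four times that factor minus two; both are positive since each factor is at least `2`.
-/
theorem VRule.size_lt {c : ScalarSymbols L} {s : VSort} {t u : VTerm L VK V s}
    (h : VRule c t u) : u.size < t.size := by
  cases h <;> simp only [VTerm.size] <;> try omega
  all_goals first | positivity | nlinarith

/-- Both alternatives pass to contexts: the size is strictly monotone in each argument, the tensor
factors being positive, and `CutExpand` is stable under adding a fixed multiset. -/
theorem VStep.size_lt_or (hS : IsScalarRewriteSystem S) {s : VSort} {t u : VTerm L VK V s}
    (h : VStep S t u) :
    u.size < t.size ∨ u.size = t.size ∧ CutExpand (· < ·) (u.ranks hS) (t.ranks hS) := by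
  induction h with
  | root h => exact .inl h.size_lt
  | scalar t h => exact .inr ⟨rfl, cutExpand_single_add (scalarRank_lt hS h) _⟩
  | smul a h ih =>
    refine ih.imp (fun ih => ?_) fun ih => ⟨?_, (cutExpand_add_left _).2 ih.2⟩
    · simp only [VTerm.size]; omega
    · simp only [VTerm.size, ih.1]
  | add_left u h ih =>
    refine ih.imp (fun ih => ?_) fun ih => ⟨?_, (cutExpand_add_right _).2 ih.2⟩
    · simp only [VTerm.size]; omega
    · simp only [VTerm.size, ih.1]
  | add_right t h ih =>
    refine ih.imp (fun ih => ?_) fun ih => ⟨?_, (cutExpand_add_left _).2 ih.2⟩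
    · simp only [VTerm.size]; omega
    · simp only [VTerm.size, ih.1]
  | tensor_left u h ih =>
    refine ih.imp (fun ih => ?_) fun ih => ⟨?_, (cutExpand_add_right _).2 ih.2⟩
    · simp only [VTerm.size]; gcongr
    · simp only [VTerm.size, ih.1]
  | tensor_right t h ih =>
    refine ih.imp (fun ih => ?_) fun ih => ⟨?_, (cutExpand_add_left _).2 ih.2⟩
    · simp only [VTerm.size]; gcongr
    · simp only [VTerm.size, ih.1]

/-- The pair of the size and the multiset of ranks of the scalars of a term. -/
noncomputable def Term.measure (hS : IsScalarRewriteSystem S) :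
    Term L VK V → ℕ × Multiset Ordinal.{u}
  | .scalar a => (0, {scalarRank hS a})
  | .vector t => (t.size, t.ranks hS)

theorem TermAC.measure_eq (hS : IsScalarRewriteSystem S) {t u : Term L VK V}
    (h : TermAC S.ac t u) : t.measure hS = u.measure hS := by
  cases h with
  | scalar h => simp only [Term.measure, scalarRank_congr hS h]
  | vector h => simp only [Term.measure, h.size_eq, h.ranks_eq hS]

theorem TermStep.measure_lt (hS : IsScalarRewriteSystem S) {t u : Term L VK V}
    (h : TermStep S t u) :
    Prod.Lex (· < ·) (CutExpand (· < ·)) (u.measure hS) (t.measure hS) := by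
  cases h with
  | scalar h => exact .right _ (cutExpand_singleton_singleton (scalarRank_lt hS h))
  | vector h => exact Prod.lex_iff.2 (h.size_lt_or hS)

theorem rewrites_terminating (hS : IsScalarRewriteSystem S) (VK : Type w)
    (V : VSort → Type x) : Terminating (Rewrites S VK V) := by
  refine Subrelation.wf ?_ (InvImage.wf (Term.measure hS)
    (WellFounded.prod_lex Nat.lt_wfRel.wf Ordinal.lt_wf.cutExpand))
  rintro b a ⟨a', b', h₁, h₂, h₃⟩
  have := h₂.measure_lt hS
  rwa [← h₁.measure_eq hS, h₃.measure_eq hS] at this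

end Termination

/-! ## Interpretation of vectors in free modules -/

section Eval

/-- The basis vectors of the interpretation of the sort `s`: the variables, and for `G` also the
tensor products of two variables. -/
inductive Atom (V : VSort → Type x) : VSort → Type x
  | var {s : VSort} (y : V s) : Atom V s
  | tensor (y : V VSort.E) (z : V VSort.F) : Atom V VSort.G

variable {V : VSort → Type x}

/-- The tensor product of two basis vectors. -/
def Atom.tmul : Atom V VSort.E → Atom V VSort.F → Atom V VSort.G
  | .var y, .var z => .tensor y z

/-- The vector term of a basis vector. -/
def Atom.toVTerm (L : FirstOrder.Language.{u, v}) (VK : Type w) :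
    {s : VSort} → Atom V s → VTerm L VK V s
  | _, .var y => .var y
  | _, .tensor y z => .tensor (.var y) (.var z)

/-- The bilinear map on free modules induced by the tensor product of basis vectors. -/
noncomputable def tensorMap (R : Type*) [CommSemiring R] (V : VSort → Type x) :
    (Atom V VSort.E →₀ R) →ₗ[R] (Atom V VSort.F →₀ R) →ₗ[R] (Atom V VSort.G →₀ R) :=
  Finsupp.linearCombination R fun p =>
    Finsupp.linearCombination R fun q => Finsupp.single (p.tmul q) 1

variable {L : FirstOrder.Language.{u, v}} {S : ScalarRules L} (hS : IsScalarRewriteSystem S)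

/-- The interpretation of a vector term without scalar variables. -/
noncomputable def VTerm.eval :
    {s : VSort} → VTerm L Empty V s → (Atom V s →₀ ClosedScalar S hS)
  | _, .var y => Finsupp.single (.var y) 1
  | _, .zero => 0
  | _, .add t u => t.eval + u.eval
  | _, .smul a t => ClosedScalar.mk hS a • t.eval
  | _, .tensor t u => tensorMap _ V t.eval u.eval

theorem VTerm.eval_atom {s : VSort} (p : Atom V s) :
    (p.toVTerm L Empty).eval hS = Finsupp.single p 1 := by
  cases p with
  | var y => rfl
  | tensor y z => simp [Atom.toVTerm, VTerm.eval, tensorMap, Atom.tmul]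

variable {hS}

/-- Each rule is an orientation of a semimodule law or of a bilinearity law. -/
theorem VRule.eval_eq {s : VSort} {t u : VTerm L Empty V s} (h : VRule S.toScalarSymbols t u) :
    t.eval hS = u.eval hS := by
  cases h <;> simp only [VTerm.eval, ClosedScalar.mk_tadd, ClosedScalar.mk_tmul,
    ClosedScalar.mk_tzero, ClosedScalar.mk_tone, _root_.add_zero, _root_.zero_smul,
    _root_.one_smul, _root_.smul_zero, mul_smul, _root_.add_smul, _root_.smul_add, map_add, map_smul, map_zero, LinearMap.add_apply,
    LinearMap.smul_apply, LinearMap.zero_apply]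

theorem VStep.eval_eq {s : VSort} {t u : VTerm L Empty V s} (h : VStep S t u) :
    t.eval hS = u.eval hS := by
  induction h with
  | root h => exact h.eval_eq
  | scalar t h => simp only [VTerm.eval, ClosedScalar.mk_eq_of_scalarStep h]
  | smul a _ ih => simp only [VTerm.eval, ih]
  | add_left u _ ih => simp only [VTerm.eval, ih]
  | add_right t _ ih => simp only [VTerm.eval, ih]
  | tensor_left u _ ih => simp only [VTerm.eval, ih]
  | tensor_right t _ ih => simp only [VTerm.eval, ih]

theorem VAC.eval_eq {s : VSort} {t u : VTerm L Empty V s} (h : VAC S.ac t u) :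
    t.eval hS = u.eval hS := by
  induction h with
  | refl => rfl
  | symm _ ih => exact ih.symm
  | trans _ _ ih₁ ih₂ => exact ih₁.trans ih₂
  | add _ _ ih₁ ih₂ => simp only [VTerm.eval, ih₁, ih₂]
  | smul ha _ ih => simp only [VTerm.eval, ih, ClosedScalar.mk_eq_of_scalarAC ha]
  | tensor _ _ ih₁ ih₂ => simp only [VTerm.eval, ih₁, ih₂]
  | comm => simp only [VTerm.eval, add_comm]
  | assoc => simp only [VTerm.eval, add_assoc]

end Eval

/-! ## Normal terms -/

section Normal

theorem VAC.equivalence {L : FirstOrder.Language.{u, v}} (ac : Set (L.Functions 2)) {VK : Type w}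
    {V : VSort → Type x} (s : VSort) : Equivalence (VAC ac (VK := VK) (V := V) (s := s)) :=
  ⟨.refl, .symm, .trans⟩

theorem TermAC.equivalence {L : FirstOrder.Language.{u, v}} (ac : Set (L.Functions 2))
    {VK : Type w} {V : VSort → Type x} : Equivalence (TermAC ac (VK := VK) (V := V)) where
  refl t := by cases t <;> constructor <;> constructor
  symm h := by
    cases h with
    | scalar h => exact .scalar h.symm
    | vector h => exact .vector h.symm
  trans h₁ h₂ := by
    cases h₁ with
    | scalar h₁ => cases h₂ with | scalar h₂ => exact .scalar (h₁.trans h₂)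
    | vector h₁ => cases h₂ with | vector h₂ => exact .vector (h₁.trans h₂)

variable {L : FirstOrder.Language.{u, v}} {S : ScalarRules L} {V : VSort → Type x}

/-- One-step rewriting on vector terms without scalar variables. -/
def VRewrites (S : ScalarRules L) {s : VSort} : VTerm L Empty V s → VTerm L Empty V s → Prop :=
  Modulo (VAC S.ac) (VStep S)

theorem VRewrites.of_rule {s : VSort} {t t' u : VTerm L Empty V s} (h : VAC S.ac t t')
    (h' : VRule S.toScalarSymbols t' u) : VRewrites S t u :=
  ⟨t', u, h, .root h', .refl u⟩

/-- Vector terms up to associativity and commutativity. -/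
def VClass (ac : Set (L.Functions 2)) (V : VSort → Type x) (s : VSort) : Type (max u x) :=
  Quot (VAC ac (VK := Empty) (V := V) (s := s))

namespace VClass

variable {ac : Set (L.Functions 2)} {s : VSort}

/-- The class of a vector term. -/
def mk (ac : Set (L.Functions 2)) (t : VTerm L Empty V s) : VClass ac V s := Quot.mk _ t

theorem mk_surjective (q : VClass ac V s) : ∃ t, mk ac t = q := Quot.exists_rep q

theorem mk_eq_iff {t u : VTerm L Empty V s} : mk ac t = mk ac u ↔ VAC ac t u :=
  ⟨fun h => ((VAC.equivalence ac s).eqvGen_iff).1 (Quot.eqvGen_exact h), fun h => Quot.sound h⟩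

/-- Only a semigroup: `t + 0` and `t` are not AC-equal. Adjoining a neutral element with `WithZero`
allows finite sums, and the empty sum then stands for the term `0`. -/
instance : AddCommSemigroup (VClass ac V s) where
  add := Quot.map₂ VTerm.add (fun t _ _ h => .add (.refl t) h) (fun _ _ t h => .add h (.refl t))
  add_assoc a b c := by
    obtain ⟨a, rfl⟩ := mk_surjective a
    obtain ⟨b, rfl⟩ := mk_surjective b
    obtain ⟨c, rfl⟩ := mk_surjective c
    exact Quot.sound (.assoc a b c)
  add_comm a b := by
    obtain ⟨a, rfl⟩ := mk_surjective a
    obtain ⟨b, rfl⟩ := mk_surjective b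
    exact Quot.sound (.comm a b)

theorem mk_add (t u : VTerm L Empty V s) : mk ac (.add t u) = mk ac t + mk ac u := rfl

/-- The class of a vector term, where the term `0` is made neutral for `+`. -/
noncomputable def ofTerm (ac : Set (L.Functions 2)) (t : VTerm L Empty V s) :
    WithZero (VClass ac V s) :=
  open Classical in if t = .zero then 0 else ↑(mk ac t)

theorem ofTerm_of_ne {t : VTerm L Empty V s} (h : t ≠ .zero) : ofTerm ac t = ↑(mk ac t) :=
  if_neg h

theorem ofTerm_zero : ofTerm ac (.zero : VTerm L Empty V s) = 0 := if_pos rfl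

theorem ofTerm_inj {t u : VTerm L Empty V s} (h : ofTerm ac t = ofTerm ac u) : VAC ac t u := by
  by_cases ht : t = .zero <;> by_cases hu : u = .zero
  · subst ht hu; exact .refl _
  · subst ht
    rw [ofTerm_zero, ofTerm_of_ne hu] at h
    exact absurd h WithZero.zero_ne_coe
  · subst hu
    rw [ofTerm_zero, ofTerm_of_ne ht] at h
    exact absurd h WithZero.coe_ne_zero
  · rw [ofTerm_of_ne ht, ofTerm_of_ne hu, WithZero.coe_inj] at h
    exact mk_eq_iff.1 h

end VClass

variable (hS : IsScalarRewriteSystem S)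

/-- A normal closed scalar in a given class. -/
noncomputable def ClosedScalar.rep (q : ClosedScalar S hS) : L.Term Empty :=
  (ClosedScalar.exists_normal_rep q).choose

/-- The canonical term for a nonzero multiple of a basis vector. -/
noncomputable def monomial {s : VSort} (p : Atom V s) (k : ClosedScalar S hS) :
    VTerm L Empty V s :=
  open Classical in
  if k = 1 then p.toVTerm L Empty else .smul (ClosedScalar.rep hS k) (p.toVTerm L Empty)

/-- A coefficient `1` is not written in a monomial; the three collecting rules of `R'` cover the
resulting four cases up to commutativity. -/
theorem VTerm.exists_add_reduct {s : VSort} (p : Atom V s) (k l : ClosedScalar S hS) :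
    ∃ r, VRewrites S (.add (monomial hS p k) (monomial hS p l)) r := by
  unfold monomial
  split_ifs
  · exact ⟨_, .of_rule (.refl _) (.add_self _)⟩
  · exact ⟨_, .of_rule (.comm _ _) (.add_smul_one _ _)⟩
  · exact ⟨_, .of_rule (.refl _) (.add_smul_one _ _)⟩
  · exact ⟨_, .of_rule (.refl _) (.add_smul _ _ _)⟩

theorem VRewrites.add_right {s : VSort} {t r : VTerm L Empty V s} (q : VTerm L Empty V s)
    (h : VRewrites S t r) : VRewrites S (.add t q) (.add r q) :=
  Modulo.map (f := fun t => VTerm.add t q) (fun _ _ h => .add h (.refl q))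
    (fun _ _ h => .add_left q h) h

theorem VRewrites.add_left {s : VSort} {t r : VTerm L Empty V s} (q : VTerm L Empty V s)
    (h : VRewrites S t r) : VRewrites S (.add q t) (.add q r) :=
  Modulo.map (f := fun t => VTerm.add q t) (fun _ _ h => .add (.refl q) h)
    (fun _ _ h => .add_right q h) h

theorem VRewrites.smul {s : VSort} {t r : VTerm L Empty V s} (a : L.Term Empty)
    (h : VRewrites S t r) : VRewrites S (.smul a t) (.smul a r) :=
  Modulo.map (f := fun t => VTerm.smul a t) (fun _ _ h => .smul (.refl a) h)
    (fun _ _ h => .smul a h) h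

theorem VRewrites.scalar {s : VSort} {a b : L.Term Empty} (t : VTerm L Empty V s)
    (h : S.Step a b) : VRewrites S (.smul a t) (.smul b t) :=
  Modulo.map (f := fun a => VTerm.smul a t) (fun _ _ h => .smul h (.refl t))
    (fun _ _ h => .scalar t h) h

theorem VRewrites.tensor_left {t r : VTerm L Empty V VSort.E} (u : VTerm L Empty V VSort.F)
    (h : VRewrites S t r) : VRewrites S (.tensor t u) (.tensor r u) :=
  Modulo.map (f := fun t => VTerm.tensor t u) (fun _ _ h => .tensor h (.refl u))
    (fun _ _ h => .tensor_left u h) h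

theorem VRewrites.tensor_right (t : VTerm L Empty V VSort.E) {u r : VTerm L Empty V VSort.F}
    (h : VRewrites S u r) : VRewrites S (.tensor t u) (.tensor t r) :=
  Modulo.map (f := fun u => VTerm.tensor t u) (fun _ _ h => .tensor (.refl t) h)
    (fun _ _ h => .tensor_right t h) h

/-- The canonical sum of monomials of a vector. -/
noncomputable def canonical {s : VSort} (f : Atom V s →₀ ClosedScalar S hS) :
    WithZero (VClass S.ac V s) :=
  f.sum fun p k => ↑(VClass.mk S.ac (monomial hS p k))

theorem canonical_single {s : VSort} (p : Atom V s) {k : ClosedScalar S hS} (hk : k ≠ 0) :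
    canonical hS (Finsupp.single p k) = ↑(VClass.mk S.ac (monomial hS p k)) := by
  classical
  rw [canonical, Finsupp.sum, Finsupp.support_single p hk, Finset.sum_singleton,
    Finsupp.single_eq_same]

theorem canonical_atom {s : VSort} (p : Atom V s) :
    canonical hS (Finsupp.single p 1) = ↑(VClass.mk S.ac (p.toVTerm L Empty)) := by
  rw [canonical_single hS p one_ne_zero, monomial, if_pos rfl]

/-- Two vectors with a common basis vector have a reducible sum. -/
theorem exists_reduct_of_canonical {s : VSort} {t u : VTerm L Empty V s}
    {f g : Atom V s →₀ ClosedScalar S hS} (ht : ↑(VClass.mk S.ac t) = canonical hS f)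
    (hu : ↑(VClass.mk S.ac u) = canonical hS g) {p : Atom V s} (hf : p ∈ f.support)
    (hg : p ∈ g.support) : ∃ r, VRewrites S (.add t u) r := by
  classical
  -- Modulo AC the two monomials at `p` can be brought together, where a collecting rule applies.
  have key : ((VClass.mk S.ac (.add t u) : VClass S.ac V s) : WithZero (VClass S.ac V s)) =
      ↑(VClass.mk S.ac (.add (monomial hS p (f p)) (monomial hS p (g p)))) +
        ((∑ q ∈ f.support.erase p, ↑(VClass.mk S.ac (monomial hS q (f q)))) +
          ∑ q ∈ g.support.erase p, ↑(VClass.mk S.ac (monomial hS q (g q)))) := by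
    rw [VClass.mk_add, VClass.mk_add, WithZero.coe_add, WithZero.coe_add, ht, hu, canonical,
      canonical, Finsupp.sum, Finsupp.sum, ← Finset.add_sum_erase _ _ hf,
      ← Finset.add_sum_erase _ _ hg, add_add_add_comm]
  obtain ⟨r, hr⟩ := VTerm.exists_add_reduct hS p (f p) (g p)
  generalize (∑ q ∈ f.support.erase p, _ + _ : WithZero (VClass S.ac V s)) = z at key
  -- The remaining monomials may be absent, in which case no term represents them.
  by_cases hz : z = 0
  · rw [hz, add_zero, WithZero.coe_inj, VClass.mk_eq_iff] at key
    exact ⟨r, hr.congr_left (VAC.equivalence _ _) key⟩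
  · obtain ⟨q, rfl⟩ := WithZero.ne_zero_iff_exists.1 hz
    obtain ⟨q, rfl⟩ := VClass.mk_surjective q
    rw [← WithZero.coe_add, WithZero.coe_inj, ← VClass.mk_add, VClass.mk_eq_iff] at key
    exact ⟨_, (hr.add_right q).congr_left (VAC.equivalence _ _) key⟩

/-- Tensors live in sort `G` only, so they never occur as arguments of a tensor. -/
theorem VTerm.eq_var_of_normal {s : VSort} (hs : s ≠ VSort.G) {t : VTerm L Empty V s}
    (h0 : t ≠ .zero) (hadd : ∀ u v, t ≠ .add u v) (hsmul : ∀ a u, t ≠ .smul a u) :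
    ∃ y, t = .var y := by
  cases t with
  | var y => exact ⟨y, rfl⟩
  | zero => exact absurd rfl h0
  | add u v => exact absurd rfl (hadd u v)
  | smul a u => exact absurd rfl (hsmul a u)
  | tensor => exact absurd rfl hs

/-- The six tensor rules match every argument that is not a variable. -/
theorem VTerm.eq_atom_of_normal_tensor {t : VTerm L Empty V VSort.E} {u : VTerm L Empty V VSort.F}
    (h : IsNormal (VRewrites S) (VTerm.tensor t u)) :
    ∃ p : Atom V VSort.G, VTerm.tensor t u = p.toVTerm L Empty := by
  have h' : ∀ r, ¬ VRule S.toScalarSymbols (VTerm.tensor t u) r :=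
    fun r hr => h r (.of_rule (.refl _) hr)
  obtain ⟨y, rfl⟩ := VTerm.eq_var_of_normal (s := .E) (t := t) nofun
    (by rintro rfl; exact h' _ (.zero_tensor u))
    (by rintro v w rfl; exact h' _ (.add_tensor v w u))
    (by rintro a v rfl; exact h' _ (.smul_tensor a v u))
  obtain ⟨z, rfl⟩ := VTerm.eq_var_of_normal (s := .F) (t := u) nofun
    (by rintro rfl; exact h' _ (.tensor_zero _))
    (by rintro v w rfl; exact h' _ (.tensor_add _ v w))
    (by rintro a v rfl; exact h' _ (.tensor_smul a _ v))
  exact ⟨.tensor y z, rfl⟩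

theorem VTerm.eq_atom_of_normal_smul {s : VSort} {a : L.Term Empty} {t : VTerm L Empty V s}
    (h : IsNormal (VRewrites S) (VTerm.smul a t)) : ∃ p : Atom V s, t = p.toVTerm L Empty := by
  have h' : ∀ r, ¬ VRule S.toScalarSymbols (VTerm.smul a t) r :=
    fun r hr => h r (.of_rule (.refl _) hr)
  cases t with
  | var y => exact ⟨.var y, rfl⟩
  | zero => exact absurd (.smul_zero a) (h' _)
  | add u v => exact absurd (.smul_add a u v) (h' _)
  | smul b u => exact absurd (.smul_smul a b u) (h' _)
  | tensor t u => exact VTerm.eq_atom_of_normal_tensor fun r hr => h _ (hr.smul a)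

/-- A normal term is the canonical term of its interpretation. -/
theorem VTerm.ofTerm_eq_canonical {s : VSort} {t : VTerm L Empty V s}
    (h : IsNormal (VRewrites S) t) : VClass.ofTerm S.ac t = canonical hS (t.eval hS) := by
  induction t with
  | var y => exact (canonical_atom hS (.var y)).symm ▸ VClass.ofTerm_of_ne (by rintro ⟨⟩)
  | zero => exact VClass.ofTerm_zero.trans Finsupp.sum_zero_index.symm
  | add t u iht ihu =>
    have ht : t ≠ .zero := by
      rintro rfl
      exact h _ (.of_rule (.comm _ _) (.add_zero u))
    have hu : u ≠ .zero := by
      rintro rfl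
      exact h _ (.of_rule (.refl _) (.add_zero t))
    specialize iht fun r hr => h _ (hr.add_right u)
    specialize ihu fun r hr => h _ (hr.add_left t)
    rw [VClass.ofTerm_of_ne ht] at iht
    rw [VClass.ofTerm_of_ne hu] at ihu
    -- A common basis vector would make the sum reducible. With disjoint supports no coefficients
    -- are added, so the canonical sums simply concatenate.
    have hd : Disjoint (t.eval hS).support (u.eval hS).support := by
      rw [Finset.disjoint_left]
      intro p hp hq
      obtain ⟨r, hr⟩ := exists_reduct_of_canonical hS iht ihu hp hq
      exact h r hr
    rw [VClass.ofTerm_of_ne (by rintro ⟨⟩), VClass.mk_add, WithZero.coe_add, iht, ihu,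
      canonical, canonical, canonical, VTerm.eval, Finsupp.sum_add_index_of_disjoint hd]
  | smul a t _ =>
    obtain ⟨p, rfl⟩ := VTerm.eq_atom_of_normal_smul h
    have ha : IsNormal S.Step a := fun b hb => h _ (.scalar _ hb)
    -- A normal scalar in the class of `0` or `1` is AC-equal to that constant, so the rule erasing
    -- it would apply modulo AC.
    have h0 : ClosedScalar.mk hS a ≠ 0 := fun h0 =>
      h _ (.of_rule (.smul (ClosedScalar.scalarAC_of_mk_eq ha hS.zero_normal h0) (.refl _))
        (.zero_smul _))
    have h1 : ClosedScalar.mk hS a ≠ 1 := fun h1 =>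
      h _ (.of_rule (.smul (ClosedScalar.scalarAC_of_mk_eq ha hS.one_normal h1) (.refl _))
        (.one_smul _))
    -- The chosen representative and `a` are both normal and in one class, hence AC-equal.
    obtain ⟨hr, hr'⟩ := (ClosedScalar.exists_normal_rep (ClosedScalar.mk hS a)).choose_spec
    rw [VClass.ofTerm_of_ne (by rintro ⟨⟩), VTerm.eval, VTerm.eval_atom, Finsupp.smul_single,
      smul_eq_mul, mul_one, canonical_single hS p h0, monomial, if_neg h1, WithZero.coe_inj,
      VClass.mk_eq_iff]
    exact .smul (ClosedScalar.scalarAC_of_mk_eq ha hr hr'.symm) (.refl _)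
  | tensor t u _ _ =>
    obtain ⟨p, hp⟩ := VTerm.eq_atom_of_normal_tensor h
    rw [hp, VTerm.eval_atom, canonical_atom, ← hp]
    exact VClass.ofTerm_of_ne (by rintro ⟨⟩)

/-- The interpretation of a term of any sort, without scalar variables. -/
noncomputable def Term.eval : Term L Empty V →
    ClosedScalar S hS ⊕ (Σ s : VSort, Atom V s →₀ ClosedScalar S hS)
  | .scalar a => .inl (ClosedScalar.mk hS a)
  | .vector t => .inr ⟨_, t.eval hS⟩

theorem TermStep.eval_eq {t u : Term L Empty V} (h : TermStep S t u) :
    t.eval hS = u.eval hS := by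
  cases h with
  | scalar h => simp only [Term.eval, ClosedScalar.mk_eq_of_scalarStep h]
  | vector h => simp only [Term.eval, h.eval_eq]

theorem TermAC.eval_eq {t u : Term L Empty V} (h : TermAC S.ac t u) :
    t.eval hS = u.eval hS := by
  cases h with
  | scalar h => simp only [Term.eval, ClosedScalar.mk_eq_of_scalarAC h]
  | vector h => simp only [Term.eval, h.eval_eq]

theorem Term.termAC_of_eval_eq {t u : Term L Empty V} (ht : IsNormal (Rewrites S Empty V) t)
    (hu : IsNormal (Rewrites S Empty V) u) (h : t.eval hS = u.eval hS) : TermAC S.ac t u := by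
  have hs : ∀ {a : L.Term Empty}, IsNormal (Rewrites S Empty V) (.scalar a) →
      IsNormal S.Step a := fun ha b hb => ha (.scalar b)
    (Modulo.map (f := Term.scalar) (fun _ _ h => .scalar h) (fun _ _ h => .scalar h) hb)
  have hv : ∀ {s : VSort} {t : VTerm L Empty V s}, IsNormal (Rewrites S Empty V) (.vector t) →
      IsNormal (VRewrites S) t := fun ha b hb => ha (.vector b)
    (Modulo.map (f := Term.vector) (fun _ _ h => .vector h) (fun _ _ h => .vector h) hb)
  cases t with
  | scalar a =>
    cases u with
    | scalar b => exact .scalar (ClosedScalar.scalarAC_of_mk_eq (hs ht) (hs hu) (Sum.inl.inj h))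
    | vector u => cases h
  | @vector s t =>
    cases u with
    | scalar b => cases h
    | @vector s' u =>
      -- The value records the sort, so both vectors have the same sort; each is then determined by
      -- its value through `canonical`.
      obtain ⟨rfl, h⟩ := Sigma.mk.inj (Sum.inr.inj h)
      refine .vector (VClass.ofTerm_inj ?_)
      rw [VTerm.ofTerm_eq_canonical hS (hv ht), VTerm.ofTerm_eq_canonical hS (hv hu),
        eq_of_heq h]

theorem rewrites_confluent {S : ScalarRules L} (hS : IsScalarRewriteSystem S) :
    ConfluentModulo (TermAC S.ac) (Rewrites S Empty V) := by
  refine confluentModulo_of_invariant (rewrites_terminating hS Empty V) (Term.eval hS) ?_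
    fun _ _ => Term.termAC_of_eval_eq hS
  rintro a b ⟨a', b', h₁, h₂, h₃⟩
  exact (h₁.eval_eq hS).trans ((h₂.eval_eq hS).trans (h₃.eval_eq hS))

end Normal

end BilinearRewriting

theorem mainTheorem10 {L : FirstOrder.Language.{u, v}} (S : BilinearRewriting.ScalarRules L)
    (hS : BilinearRewriting.IsScalarRewriteSystem S)
    (V : BilinearRewriting.VSort → Type x) :
    (∀ VK : Type w, BilinearRewriting.Terminating (BilinearRewriting.Rewrites S VK V)) ∧
      BilinearRewriting.ConfluentModulo (BilinearRewriting.TermAC S.ac)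
        (BilinearRewriting.Rewrites S Empty V) :=
  ⟨fun VK => BilinearRewriting.rewrites_terminating hS VK V,
    BilinearRewriting.rewrites_confluent hS⟩
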